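/- A real is a subset of $\mathbb{N}$. A set $D\subseteq\mathbb{N}$ has density 1 if $\lim_{n\to\infty}|D\cap\{0,\dots,n-1\}|/n=1$. A real $C$ is generically computable if there is a partial recursive $\{0,1\}$-valued function $\varphi$ whose domain has density 1 such that, for every $n$ in its domain, $\varphi(n)=1$ implies $n\in C$ and $\varphi(n)=0$ implies $n\notin C$. For a real $X$, $C$ is generically $X$-computable if there is such a $\varphi$ that is partial recursive relative to the oracle $X$. Nonrecursive reals $A$ and $B$ form a minimal pair for generic computability if every real that is both generically $A$-computable and generically $B$-computable is generically computable. Theorem. For any nonrecursive reals $A$ and $B$ (and thus for any non-generically-computable reals $A$ and $B$), there exists a real $C$ such that $C$ is not generically computable, but $C$ is both generically $A$-computable and generically $B$-computable. Consequently, there are no minimal pairs for generic computability. -/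

import Mathlib

open Filter Topology

/-- A set of natural numbers has density 1 if `|A ∩ {0, …, n - 1}| / n → 1` as `n → ∞`. -/
def HasDensityOne (A : Set ℕ) : Prop :=
  Tendsto (fun n : ℕ => ((A ∩ Set.Iio n).ncard : ℝ) / (n : ℝ)) atTop (𝓝 1)

/-- A real (a set of natural numbers) is recursive. -/
def IsRecursive (A : Set ℕ) : Prop :=
  ComputablePred fun n : ℕ => n ∈ A

open Classical in
/-- The characteristic function of a real, as a (total) function that can serve as an oracle. -/
noncomputable def charFun (A : Set ℕ) : ℕ →. ℕ :=
  fun n => Part.some (if n ∈ A then 1 else 0)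

/-- `φ` is a `{0,1}`-valued partial function whose domain has density 1 and all of whose
values are correct values of the characteristic function of `A`. -/
structure IsGenericDescription (φ : ℕ →. ℕ) (A : Set ℕ) : Prop where
  dom_density : HasDensityOne φ.Dom
  zero_or_one : ∀ n, ∀ b ∈ φ n, b = 0 ∨ b = 1
  mem_of_one : ∀ n, 1 ∈ φ n → n ∈ A
  notMem_of_zero : ∀ n, 0 ∈ φ n → n ∉ A

/-- `A` is generically computable. -/
def GenericallyComputable (A : Set ℕ) : Prop :=
  ∃ φ : ℕ →. ℕ, Partrec φ ∧ IsGenericDescription φ A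

/-- `A` is generically `B`-computable: there is a generic computation of `A` that uses `B`
as an oracle. -/
def GenericallyComputableFrom (B A : Set ℕ) : Prop :=
  ∃ φ : ℕ →. ℕ, RecursiveIn {charFun B} φ ∧ IsGenericDescription φ A

/-- `A` and `B` form a minimal pair for generic computability: both are nonrecursive, and every
real that is both generically `A`-computable and generically `B`-computable is generically
computable. -/
def IsMinimalPairForGenericComputability (A B : Set ℕ) : Prop :=
  ¬ IsRecursive A ∧ ¬ IsRecursive B ∧
    ∀ C : Set ℕ, GenericallyComputableFrom A C → GenericallyComputableFrom B C →
      GenericallyComputable C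

/-!
The real `C` is built inside `E ∩ E'`, where the complement of `E` is recursively enumerable in `A`,
that of `E'` is recursively enumerable in `B`, and both complements have density 1.  Then `C` is
generically computed from `A` by the function that is `0` off `E` and undefined on `E`, and from
`B` likewise.  If moreover every recursively enumerable set `W` of density 1 meets `E ∩ E'`, then
`C` can be chosen so as to disagree with every partial recursive function whose domain has
density 1 (`exists_real_of_isNegligibleFrom`).  So the task is to find such sparse sets `E`, `E'`.

The elements for the `e`-th function are sought in a block of positive density reserved for `e`,
which is cut into dyadic levels; let `W` be the domain of this function.  A set of density 1 meets
almost every level of the block (`exists_block_level_of_hasDensityOne`), and a set with at most one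
element in almost every level of each block has density 0 (`hasDensityOne_compl`).  Two kinds of
sparse sets are used.

If `Z` is limit computable but not recursive, it computes a monotone function `f` that no
computable function dominates (`exists_not_isDominated`).  The set `boundedHits f` has in each level
only the first element enumerated into `W`, and only if this happens within the time given by `f`.

If `Z` is not limit computable, `pendingHits i Z` is used.  Each level is assigned a finite string,
a node of the binary tree, and the levels whose string disagrees with `Z` are omitted.  The nodes
are those visited by a search through the tree that goes deeper while `W` does not enumerate
elements in the levels assigned to the current branch, and backtracks once it does.
A level that is not omitted is contained in `pendingHits i Z` for as long as `W` has enumerated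
nothing in it and its node lies on the current branch of the search; once `W` has enumerated an
element in it, only the first such element is kept.  Were infinitely many levels to remain complete,
their strings would form a single branch, the limit of the search, from which `Z` can be read off,
and `Z` would be limit computable (`hasDensityOne_compl_pendingHits`).

If `W` has density 1, the search always comes to an end and starts again (`exists_restart`), and
during each complete search every infinite branch passes through a node in whose level `W` has
enumerated an element (`exists_hit_between_restarts`).  Applied to the branch that interleaves `A`
and `B`, this yields an element of `W ∩ E ∩ E'` at once if neither real is limit computable.
Otherwise the end of some complete search must be reached within the time given by the undominated
functions.  The end of the first complete search after stage `n` is bounded by a computable function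
of `n`, so one undominated monotone function suffices (`exists_hit_le`); for two limit computable
reals it can be arranged that the minimum of the two functions is undominated
(`exists_min_not_isDominated`).
-/

/-! ### A backtracking search on the binary tree -/

/-- Backtracking: remove the right branches on top of the stack and turn the left branch below them
into a right branch with time stamp `k`.  If there is no left branch, the whole tree has been
searched and the search is restarted with the single root entry `(true, k)`. -/
def backtrack (k : ℕ) : List (Bool × ℕ) → List (Bool × ℕ)
  | [] => [(true, k)]
  | p :: r => bif p.1 then backtrack k r else (true, k) :: r

/-- The stack of a depth-first search through the binary tree, at stage `n`.  An entry `(b, m)` is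
a branching direction together with the stage at which the node was reached; the top of the stack
is the head of the list and the root is the last entry `(true, _)`.  As long as no
node on the current branch has been hit, the search moves on to the left child; otherwise it
backtracks.  Here `hit m n` says that the node reached at stage `m` has been hit by stage `n`. -/
def searchStack (hit : ℕ → ℕ → Bool) : ℕ → List (Bool × ℕ)
  | 0 => [(true, 0)]
  | n + 1 =>
    bif (searchStack hit n).any (fun p => hit p.2 n) then backtrack (n + 1) (searchStack hit n)
    else (false, n + 1) :: searchStack hit n

/-- The direction at height `q` (counted from the root) of the branch described by a stack. -/
def direction (r : List (Bool × ℕ)) (q : ℕ) : Option Bool :=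
  (r.reverse[q]?).map Prod.fst

/-- The branch described by a stack is an initial segment of `Y`. -/
def IsPrefixOf (Y : ℕ → Bool) (r : List (Bool × ℕ)) : Prop :=
  ∀ q b, direction r q = some b → b = Y q

/-- The infinite branch `Y` lies to the left of the branch described by a stack. -/
def IsLeftOf (Y : ℕ → Bool) : List (Bool × ℕ) → Prop
  | [] => False
  | p :: r => IsLeftOf Y r ∨ (IsPrefixOf Y r ∧ p.1 = true ∧ Y r.length = false)

theorem direction_eq_of_suffix {t r : List (Bool × ℕ)} (h : t <:+ r) {q : ℕ} {b : Bool}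
    (hb : direction t q = some b) : direction r q = some b := by
  obtain ⟨u, rfl⟩ := h
  unfold direction at *
  rw [List.reverse_append]
  rw [Option.map_eq_some_iff] at hb ⊢
  obtain ⟨a, ha, rfl⟩ := hb
  refine ⟨a, ?_, rfl⟩
  have := (List.getElem?_eq_some_iff.1 ha).1
  rw [List.getElem?_append_left this, ha]

theorem isPrefixOf_of_suffix {Y : ℕ → Bool} {t r : List (Bool × ℕ)} (h : t <:+ r)
    (hr : IsPrefixOf Y r) : IsPrefixOf Y t :=
  fun q b hb => hr q b (direction_eq_of_suffix h hb)

theorem isPrefixOf_nil (Y : ℕ → Bool) : IsPrefixOf Y [] := by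
  intro q b h
  simp [direction] at h

theorem isPrefixOf_cons {Y : ℕ → Bool} {p : Bool × ℕ} {r : List (Bool × ℕ)} :
    IsPrefixOf Y (p :: r) ↔ IsPrefixOf Y r ∧ p.1 = Y r.length := by
  constructor
  · intro h
    refine ⟨isPrefixOf_of_suffix (List.suffix_cons p r) h, h _ _ ?_⟩
    simp [direction]
  · rintro ⟨h, hp⟩ q b hb
    rcases lt_trichotomy q r.length with hq | hq | hq
    · apply h q b
      simp only [direction, List.reverse_cons] at hb ⊢
      rwa [List.getElem?_append_left (by simpa using hq)] at hb
    · subst hq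
      simp only [direction, List.reverse_cons] at hb
      rw [List.getElem?_append_right (by simp)] at hb
      simp at hb
      rw [← hb, hp]
    · simp only [direction, List.reverse_cons] at hb
      rw [List.getElem?_eq_none (by simp; omega)] at hb
      simp at hb

theorem direction_isSome {r : List (Bool × ℕ)} {q : ℕ} (h : q < r.length) :
    ∃ b, direction r q = some b := by
  refine ⟨(r.reverse[q]'(by simpa using h)).1, ?_⟩
  simp only [direction]
  rw [List.getElem?_eq_getElem (by simpa using h)]
  rfl

theorem exists_backtrack_eq (k : ℕ) (r : List (Bool × ℕ)) :
    ∃ t, backtrack k r = (true, k) :: t ∧ t <:+ r := by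
  induction r with
  | nil => exact ⟨[], rfl, List.suffix_rfl⟩
  | cons p r ih =>
    obtain ⟨t, ht, hs⟩ := ih
    rcases p with ⟨_ | _, m⟩
    · exact ⟨r, rfl, List.suffix_cons _ _⟩
    · exact ⟨t, ht, hs.trans (List.suffix_cons _ _)⟩

section
variable (hit : ℕ → ℕ → Bool)

theorem exists_searchStack_succ_eq (s : ℕ) :
    ∃ b t, searchStack hit (s + 1) = (b, s + 1) :: t ∧ t <:+ searchStack hit s := by
  rw [searchStack]
  cases (searchStack hit s).any (fun p => hit p.2 s)
  · exact ⟨false, _, rfl, List.suffix_rfl⟩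
  · obtain ⟨t, ht, hs⟩ := exists_backtrack_eq (s + 1) (searchStack hit s)
    exact ⟨true, t, ht, hs⟩

theorem exists_searchStack_eq_cons (s : ℕ) : ∃ b t, searchStack hit s = (b, s) :: t := by
  cases s with
  | zero => exact ⟨true, [], rfl⟩
  | succ s =>
    obtain ⟨b, t, h, -⟩ := exists_searchStack_succ_eq hit s
    exact ⟨b, t, h⟩

variable {hit}

/-- The part of the stack from an entry downwards is the stack at the stage when that entry was
made. -/
theorem eq_searchStack_of_suffix {s m : ℕ} {b : Bool} {t : List (Bool × ℕ)}
    (h : (b, m) :: t <:+ searchStack hit s) : (b, m) :: t = searchStack hit m ∧ m ≤ s := by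
  induction s with
  | zero =>
    rw [searchStack] at h
    rcases List.suffix_cons_iff.1 h with h | h
    · simp only [List.cons.injEq, Prod.mk.injEq] at h
      obtain ⟨⟨rfl, rfl⟩, rfl⟩ := h
      exact ⟨rfl, le_rfl⟩
    · simp at h
  | succ s ih =>
    obtain ⟨b', t', h', hs⟩ := exists_searchStack_succ_eq hit s
    rw [h'] at h
    rcases List.suffix_cons_iff.1 h with h | h
    · rw [h]
      simp only [List.cons.injEq, Prod.mk.injEq] at h
      rw [h.1.2, h']
      exact ⟨rfl, le_rfl⟩
    · have := ih (h.trans hs)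
      exact ⟨this.1, this.2.trans (Nat.le_succ s)⟩

theorem searchStack_suffix_of_mem {s m : ℕ} {b : Bool} (h : (b, m) ∈ searchStack hit s) :
    searchStack hit m <:+ searchStack hit s ∧ m ≤ s := by
  obtain ⟨u, t, hu⟩ := List.append_of_mem h
  have h2 : (b, m) :: t <:+ searchStack hit s := ⟨u, hu.symm⟩
  have := eq_searchStack_of_suffix h2
  exact ⟨this.1 ▸ h2, this.2⟩

theorem any_stamp_iff {s m : ℕ} :
    (searchStack hit s).any (fun p => p.2 == m) = true ↔
      searchStack hit m <:+ searchStack hit s := by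
  rw [List.any_eq_true]
  constructor
  · rintro ⟨⟨b, k⟩, hp, hk⟩
    have : k = m := by simpa using hk
    subst this
    exact (searchStack_suffix_of_mem hp).1
  · intro h
    obtain ⟨b, t, ht⟩ := exists_searchStack_eq_cons hit m
    exact ⟨(b, m), h.subset (by rw [ht]; simp), by simp⟩

theorem searchStack_suffix_of_le {m s s' : ℕ} (h : searchStack hit m <:+ searchStack hit s)
    (hm : m ≤ s') (hs : s' ≤ s) : searchStack hit m <:+ searchStack hit s' := by
  obtain ⟨d, rfl⟩ := Nat.exists_eq_add_of_le hs
  clear hs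
  induction d with
  | zero => exact h
  | succ d ih =>
    apply ih
    obtain ⟨b', t', h', hs⟩ := exists_searchStack_succ_eq hit (s' + d)
    obtain ⟨b, t, ht⟩ := exists_searchStack_eq_cons hit m
    rw [← add_assoc, h'] at h
    rcases List.suffix_cons_iff.1 h with h | h
    · rw [ht] at h
      simp only [List.cons.injEq, Prod.mk.injEq] at h
      omega
    · exact h.trans hs

theorem le_of_searchStack_suffix {m s : ℕ} (h : searchStack hit m <:+ searchStack hit s) :
    m ≤ s := by
  obtain ⟨b, t, ht⟩ := exists_searchStack_eq_cons hit m
  rw [ht] at h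
  exact (eq_searchStack_of_suffix h).2

/-- Backtracking either restarts the search or replaces some left branch of the stack. -/
theorem backtrack_cases (k : ℕ) (r : List (Bool × ℕ)) :
    (backtrack k r = [(true, k)] ∧ ∀ p ∈ r, p.1 = true) ∨
      ∃ m t u, r = u ++ (false, m) :: t ∧ (∀ p ∈ u, p.1 = true) ∧
        backtrack k r = (true, k) :: t := by
  induction r with
  | nil => exact Or.inl ⟨rfl, by simp⟩
  | cons p r ih =>
    rcases p with ⟨_ | _, m⟩
    · exact Or.inr ⟨m, r, [], rfl, by simp, rfl⟩
    · rcases ih with ⟨h, h'⟩ | ⟨m', t, u, h, hu, h'⟩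
      · exact Or.inl ⟨h, by simpa using h'⟩
      · refine Or.inr ⟨m', t, (true, m) :: u, by simp [h], by simpa using hu, h'⟩

/-- If the search is not restarted after stage `N`, then infinitely many nodes stay on the stack
forever: take a later stage at which the stack is as low as possible. -/
theorem exists_permanent_of_no_restart {N : ℕ}
    (hN : ∀ t, N < t → searchStack hit t ≠ [(true, t)]) :
    ∃ n, N ≤ n ∧ ∀ m, n ≤ m → searchStack hit n <:+ searchStack hit m := by
  classical
  let μ : ℕ → ℕ := fun n =>
    2 * (searchStack hit n).length + (bif ((searchStack hit n).headI).1 then 0 else 1)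
  obtain ⟨n, hn, hmin⟩ : ∃ n, N ≤ n ∧ ∀ m, N ≤ m → μ n ≤ μ m := by
    have hne : (μ '' {n | N ≤ n}).Nonempty := ⟨_, N, le_refl N, rfl⟩
    obtain ⟨n, hn, hn'⟩ := Nat.sInf_mem hne
    exact ⟨n, hn, fun m hm => hn' ▸ Nat.sInf_le ⟨m, hm, rfl⟩⟩
  refine ⟨n, hn, fun m hm => ?_⟩
  induction m, hm using Nat.le_induction with
  | base => exact List.suffix_rfl
  | succ m hm ih =>
    have hmu := hmin (m + 1) (by omega)
    have hno := hN (m + 1) (by omega)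
    rw [searchStack] at hno ⊢
    simp only [μ] at hmu
    rw [searchStack.eq_2 hit m] at hmu
    revert hno hmu
    cases hd : (searchStack hit m).any (fun p => hit p.2 m)
    · intro _ _
      exact ih.trans (List.suffix_cons _ _)
    · simp only [cond_true]
      intro hmu hno
      rcases backtrack_cases (m + 1) (searchStack hit m) with ⟨h, -⟩ | ⟨k, t, u, h, hu, h'⟩
      · exact absurd h hno
      · rw [h'] at hmu ⊢
        rw [h] at ih
        have h2 : (false, k) :: t <:+ u ++ (false, k) :: t := List.suffix_append _ _
        rcases Nat.lt_or_ge t.length (searchStack hit n).length with hl | hl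
        · -- the replaced entry cannot belong to the stack of stage `n`, by minimality
          have h3 := List.suffix_of_suffix_length_le h2 ih (by simpa using hl)
          simp only [List.length_cons, List.headI_cons, cond_true] at hmu
          have h4 := h3.eq_of_length (by simp; omega)
          rw [← h4] at hmu
          simp at hmu
        · have h3 : t <:+ u ++ (false, k) :: t := (List.suffix_cons _ _).trans h2
          exact (List.suffix_of_suffix_length_le ih h3 hl).trans (List.suffix_cons _ _)

/-- A node that stays on the stack forever is never hit: otherwise the search would backtrack at
every later stage, and each time the number of open left branches decreases. -/
theorem not_hit_of_permanent (hmono : ∀ m s s', s ≤ s' → hit m s = true → hit m s' = true) {n : ℕ}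
    (hn : ∀ m, n ≤ m → searchStack hit n <:+ searchStack hit m) (s : ℕ) : hit n s = false := by
  by_contra hs
  have hs : hit n s = true := by simpa using hs
  have key : ∀ m, n ≤ m → s ≤ m →
      (searchStack hit (m + 1)).countP (fun p => !p.1) <
        (searchStack hit m).countP (fun p => !p.1) := by
    intro m hnm hsm
    have hdead : (searchStack hit m).any (fun p => hit p.2 m) = true := by
      obtain ⟨b, t, ht⟩ := exists_searchStack_eq_cons hit n
      rw [List.any_eq_true]
      exact ⟨(b, n), (hn m hnm).subset (by rw [ht]; simp), hmono n s m hsm hs⟩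
    have hstep : searchStack hit (m + 1) = backtrack (m + 1) (searchStack hit m) := by
      rw [searchStack, hdead, cond_true]
    rcases backtrack_cases (m + 1) (searchStack hit m) with ⟨h, -⟩ | ⟨k, t, u, h, hu, h'⟩
    · exfalso
      have h1 := hn (m + 1) (by omega)
      obtain ⟨b, t, ht⟩ := exists_searchStack_eq_cons hit n
      rw [hstep, h, ht] at h1
      have := h1.subset (List.mem_cons_self)
      simp at this
      omega
    · rw [hstep, h', h]
      simp
      omega
  have key2 : ∀ d, (searchStack hit (max n s + d)).countP (fun p => !p.1) + d ≤
      (searchStack hit (max n s)).countP (fun p => !p.1) := by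
    intro d
    induction d with
    | zero => simp
    | succ d ih =>
      have := key (max n s + d) (by omega) (by omega)
      rw [← add_assoc (max n s) d 1]
      omega
  have := key2 ((searchStack hit (max n s)).countP (fun p => !p.1) + 1)
  omega

/-- If almost every node is hit eventually, then the search is restarted infinitely often. -/
theorem exists_restart (hmono : ∀ m s s', s ≤ s' → hit m s = true → hit m s' = true) {N₀ : ℕ}
    (h : ∀ n, N₀ ≤ n → ∃ s, hit n s = true) (N : ℕ) :
    ∃ t, N < t ∧ searchStack hit t = [(true, t)] := by
  by_contra hc
  push Not at hc
  obtain ⟨n, hn, hp⟩ := exists_permanent_of_no_restart (hit := hit) (N := max N N₀)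
    (fun t ht => hc t (by omega))
  obtain ⟨s, hs⟩ := h n (by omega)
  rw [not_hit_of_permanent hmono hp s] at hs
  exact Bool.false_ne_true hs

theorem le_stamp_of_restart {b n : ℕ} (hb : searchStack hit b = [(true, b)]) (hn : b ≤ n) :
    ∀ p ∈ searchStack hit n, b ≤ p.2 := by
  induction n, hn using Nat.le_induction with
  | base => simp [hb]
  | succ n hn ih =>
    obtain ⟨c, t, h, hs⟩ := exists_searchStack_succ_eq hit n
    rw [h]
    intro p hp
    rcases List.mem_cons.1 hp with rfl | hp
    · exact hn.trans (Nat.le_succ n)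
    · exact ih p (hs.subset hp)

theorem isLeftOf_append {Y : ℕ → Bool} {r : List (Bool × ℕ)} (u : List (Bool × ℕ))
    (h : IsLeftOf Y r) : IsLeftOf Y (u ++ r) := by
  induction u with
  | nil => exact h
  | cons p u ih => exact Or.inl ih

theorem isPrefixOf_append {Y : ℕ → Bool} {r u : List (Bool × ℕ)} (hu : ∀ p ∈ u, p.1 = true)
    (hr : IsPrefixOf Y r) (h : ¬ IsLeftOf Y (u ++ r)) : IsPrefixOf Y (u ++ r) := by
  induction u with
  | nil => exact hr
  | cons p u ih =>
    have h1 : IsPrefixOf Y (u ++ r) :=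
      ih (fun q hq => hu q (List.mem_cons_of_mem _ hq)) (fun h' => h (Or.inl h'))
    have hp := hu p List.mem_cons_self
    refine isPrefixOf_cons.2 ⟨h1, ?_⟩
    rw [hp]
    by_contra hc
    exact h (Or.inr ⟨h1, hp, by simpa using Ne.symm hc⟩)

theorem root_eq_true {s k : ℕ} {c : Bool} (h : [(c, k)] <:+ searchStack hit s) : c = true := by
  have h1 := (eq_searchStack_of_suffix h).1
  cases k with
  | zero => simpa [searchStack] using h1
  | succ k =>
    cases hd : (searchStack hit k).any (fun p => hit p.2 k)
    · rw [searchStack, hd, cond_false] at h1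
      obtain ⟨b, t, ht⟩ := exists_searchStack_eq_cons hit k
      simp [ht] at h1
    · rw [searchStack, hd, cond_true] at h1
      obtain ⟨t, ht, -⟩ := exists_backtrack_eq (k + 1) (searchStack hit k)
      rw [ht] at h1
      simp only [List.cons.injEq, Prod.mk.injEq] at h1
      exact h1.1.1

/-- Between two restarts of the search, every infinite branch runs through a node that is hit while
it is on the stack.  Otherwise the branch would never be to the left of the current node,
and the search could not have come to its end. -/
theorem exists_hit_between_restarts {Y : ℕ → Bool} (hY : Y 0 = true) {b t : ℕ}
    (hb : searchStack hit b = [(true, b)]) (ht : searchStack hit t = [(true, t)]) (hbt : b < t) :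
    ∃ m s, b ≤ m ∧ s < t ∧ searchStack hit m <:+ searchStack hit s ∧ hit m s = true ∧
      IsPrefixOf Y (searchStack hit m) := by
  by_contra hc
  push Not at hc
  have hdead : ∀ n, b ≤ n → n < t → (searchStack hit n).any (fun p => hit p.2 n) = true →
      ¬ IsPrefixOf Y (searchStack hit n) := by
    intro n hbn hnt hany hpre
    obtain ⟨⟨c, m⟩, hp, hh⟩ := List.any_eq_true.1 hany
    have := searchStack_suffix_of_mem hp
    exact hc m n (le_stamp_of_restart hb hbn _ hp) hnt this.1 hh (isPrefixOf_of_suffix this.1 hpre)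
  have hstep : ∀ n, b ≤ n → n < t → ¬ IsLeftOf Y (searchStack hit n) →
      ¬ IsLeftOf Y (searchStack hit (n + 1)) ∧ searchStack hit (n + 1) ≠ [(true, n + 1)] := by
    intro n hbn hnt hleft
    cases hd : (searchStack hit n).any (fun p => hit p.2 n)
    · have hst : searchStack hit (n + 1) = (false, n + 1) :: searchStack hit n := by
        rw [searchStack, hd, cond_false]
      rw [hst]
      refine ⟨?_, by simp⟩
      rintro (h | ⟨-, h, -⟩)
      · exact hleft h
      · exact Bool.false_ne_true h
    · have hst : searchStack hit (n + 1) = backtrack (n + 1) (searchStack hit n) := by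
        rw [searchStack, hd, cond_true]
      have hnp := hdead n hbn hnt hd
      rcases backtrack_cases (n + 1) (searchStack hit n) with ⟨h, h1⟩ | ⟨k, t', u, h, hu, h'⟩
      · have := isPrefixOf_append (Y := Y) (r := []) h1 (isPrefixOf_nil Y) (by simpa using hleft)
        exact absurd (by simpa using this) hnp
      · have hl : ¬ IsLeftOf Y ((true, n + 1) :: t') := by
          rintro (hl | ⟨hp, -, hy⟩)
          · apply hleft
            rw [h]
            exact isLeftOf_append u (Or.inl hl)
          · apply hnp
            rw [h] at hleft ⊢
            exact isPrefixOf_append hu (isPrefixOf_cons.2 ⟨hp, hy.symm⟩) hleft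
        rw [hst, h']
        refine ⟨hl, fun he => ?_⟩
        have : t' = [] := by simpa using he
        subst this
        exact Bool.false_ne_true (root_eq_true (hit := hit) (s := n) (k := k) ⟨u, h.symm⟩)
  have hall : ∀ n, b ≤ n → n < t → ¬ IsLeftOf Y (searchStack hit n) := by
    intro n hbn
    induction n, hbn using Nat.le_induction with
    | base =>
      intro _
      rw [hb]
      rintro (h | ⟨-, -, h⟩)
      · exact h
      · simp [hY] at h
    | succ n hbn ih =>
      intro hnt
      exact (hstep n hbn (by omega) (ih (by omega))).1
  obtain ⟨t, rfl⟩ : ∃ t', t = t' + 1 := ⟨t - 1, by omega⟩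
  exact (hstep t (by omega) (by omega) (hall t (by omega) (by omega))).2 ht

/-- The branch described by a stack agrees with `Z` on the heights `2 * k + 1 + i`; for
`i = 0` and `i = 1` this makes a stack describe initial segments of a pair of reals. -/
def AgreesOn (i : ℕ) (Z : ℕ → Bool) (r : List (Bool × ℕ)) : Prop :=
  ∀ k b, direction r (2 * k + 1 + i) = some b → b = Z k

/-- The nodes that stay on the stack forever form a single branch.  If infinitely many of them
agree with `Z`, then `Z` can be read off that branch. -/
theorem eventually_direction_eq {i : ℕ} {Z : ℕ → Bool}
    (h : ∀ N, ∃ n, N ≤ n ∧ AgreesOn i Z (searchStack hit n) ∧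
      ∀ m, n ≤ m → searchStack hit n <:+ searchStack hit m) (k : ℕ) :
    ∀ᶠ s in atTop, direction (searchStack hit s) (2 * k + 1 + i) = some (Z k) := by
  have key : ∀ l, ∃ n, l < (searchStack hit n).length ∧ AgreesOn i Z (searchStack hit n) ∧
      ∀ m, n ≤ m → searchStack hit n <:+ searchStack hit m := by
    intro l
    induction l with
    | zero =>
      obtain ⟨n, -, hn⟩ := h 0
      obtain ⟨b, t, ht⟩ := exists_searchStack_eq_cons hit n
      exact ⟨n, by simp [ht], hn⟩
    | succ l ih =>
      obtain ⟨n, hl, hn⟩ := ih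
      obtain ⟨n', hnn', hn'⟩ := h (n + 1)
      refine ⟨n', ?_, hn'⟩
      have hs := hn.2 n' (by omega)
      have hle := hs.length_le
      refine lt_of_le_of_ne (by omega) fun he => ?_
      have heq := hs.eq_of_length (by omega)
      have := le_of_searchStack_suffix (hit := hit) (m := n') (s := n) (heq ▸ List.suffix_rfl)
      omega
  obtain ⟨n, hl, ha, hn⟩ := key (2 * k + 1 + i)
  obtain ⟨b, hb⟩ := direction_isSome hl
  have := ha k b hb
  subst this
  filter_upwards [eventually_ge_atTop n] with s hs
  exact direction_eq_of_suffix (hn s hs) hb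

end

/-! ### Dyadic blocks and density -/

/-- The exponent of `2` in `x + 1`.  The sets `{x | block x = e}` partition the natural numbers
into sets of density `2 ^ (-(e + 1))`. -/
def block (x : ℕ) : ℕ := padicValNat 2 (x + 1)

/-- The level of `x` is the `n` with `2 ^ n ≤ x + 1 < 2 ^ (n + 1)`. -/
def level (x : ℕ) : ℕ := Nat.log 2 (x + 1)

theorem exists_block_level_of_hasDensityOne {W : Set ℕ} (hW : HasDensityOne W) (e : ℕ) :
    ∃ N, ∀ n, N ≤ n → ∃ x ∈ W, block x = e ∧ level x = n := by
  have h1 : ∀ᶠ m : ℕ in atTop,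
      (1 - 1 / 2 ^ (e + 2) : ℝ) < ((W ∩ Set.Iio m).ncard : ℝ) / (m : ℝ) :=
    hW.eventually (lt_mem_nhds (by simp))
  obtain ⟨M, hM⟩ := eventually_atTop.1 h1
  refine ⟨M + e + 1, fun n hn => ?_⟩
  by_contra hc
  push Not at hc
  have hlt : n + 1 < 2 ^ (n + 1) := Nat.lt_two_pow_self
  have h2 := hM (2 ^ (n + 1)) (by omega)
  -- `g` enumerates the elements of block `e` and level `n`
  let g : ℕ → ℕ := fun i => 2 ^ n + 2 ^ e + i * 2 ^ (e + 1) - 1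
  have hpos : 0 < 2 ^ e := by positivity
  have hpos' : 0 < 2 ^ (e + 1) := by positivity
  have hg : ∀ i, g i + 1 = 2 ^ n + 2 ^ e + i * 2 ^ (e + 1) := by
    intro i
    simp only [g]
    omega
  obtain ⟨d, rfl⟩ : ∃ d, n = e + 1 + d := ⟨n - e - 1, by omega⟩
  have hb : ∀ i, block (g i) = e := by
    intro i
    have : g i + 1 = 2 ^ e * (2 * (2 ^ d + i) + 1) := by
      rw [hg]
      ring
    unfold block
    rw [this, padicValNat.mul (by positivity) (by omega), padicValNat.prime_pow,
      padicValNat.eq_zero_of_not_dvd (by omega)]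
    rfl
  have hbound : ∀ i, i < 2 ^ d → g i + 1 < 2 ^ (e + 1 + d + 1) := by
    intro i hi
    have h3 : (i + 1) * 2 ^ (e + 1) ≤ 2 ^ d * 2 ^ (e + 1) := Nat.mul_le_mul_right _ hi
    have h4 : 2 ^ d * 2 ^ (e + 1) = 2 ^ (e + 1 + d) := by ring
    have h5 : 2 ^ (e + 1 + d + 1) = 2 * 2 ^ (e + 1 + d) := by ring
    have h6 : 2 ^ (e + 1) = 2 * 2 ^ e := by ring
    have h7 : (i + 1) * 2 ^ (e + 1) = i * 2 ^ (e + 1) + 2 ^ (e + 1) := by ring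
    rw [hg]
    omega
  have hl : ∀ i, i < 2 ^ d → level (g i) = e + 1 + d := by
    intro i hi
    unfold level
    rw [Nat.log_eq_iff (by left; omega)]
    refine ⟨?_, hbound i hi⟩
    rw [hg]
    omega
  have hinj : Function.Injective g := by
    intro i j hij
    have : g i + 1 = g j + 1 := by rw [hij]
    rw [hg, hg] at this
    have := Nat.add_left_cancel this
    exact Nat.eq_of_mul_eq_mul_right hpos' this
  let S : Finset ℕ := (Finset.range (2 ^ d)).image g
  have hS : S.card = 2 ^ d := by
    rw [Finset.card_image_of_injective _ hinj, Finset.card_range]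
  have hsub : (W ∩ Set.Iio (2 ^ (e + 1 + d + 1))) ⊆
      ((Finset.range (2 ^ (e + 1 + d + 1)) \ S : Finset ℕ) : Set ℕ) := by
    rintro x ⟨hxW, hx⟩
    simp only [Finset.coe_sdiff, Set.mem_sdiff, Finset.mem_coe, Finset.mem_range]
    refine ⟨hx, fun hxS => ?_⟩
    obtain ⟨i, hi, rfl⟩ := Finset.mem_image.1 hxS
    exact hc _ hxW (hb i) (hl i (Finset.mem_range.1 hi))
  have hSsub : S ⊆ Finset.range (2 ^ (e + 1 + d + 1)) := by
    intro x hxS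
    obtain ⟨i, hi, rfl⟩ := Finset.mem_image.1 hxS
    have := hbound i (Finset.mem_range.1 hi)
    exact Finset.mem_range.2 (by omega)
  have hcard := Set.ncard_le_ncard hsub (Finset.finite_toSet _)
  rw [Set.ncard_coe_finset, Finset.card_sdiff_of_subset hSsub, hS, Finset.card_range] at hcard
  have hcard' : (W ∩ Set.Iio (2 ^ (e + 1 + d + 1))).ncard + 2 ^ d ≤ 2 ^ (e + 1 + d + 1) := by
    have : 2 ^ d ≤ 2 ^ (e + 1 + d + 1) := Nat.pow_le_pow_right (by norm_num) (by omega)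
    omega
  have hcardR : ((W ∩ Set.Iio (2 ^ (e + 1 + d + 1))).ncard : ℝ) + 2 ^ d ≤
      2 ^ (e + 1 + d + 1) := by exact_mod_cast hcard'
  rw [lt_div_iff₀ (by positivity)] at h2
  have h8 : (1 - 1 / 2 ^ (e + 2) : ℝ) * ((2 ^ (e + 1 + d + 1) : ℕ) : ℝ) =
      2 ^ (e + 1 + d + 1) - 2 ^ d := by
    push_cast
    field_simp
    ring
  linarith

theorem card_le_of_subsingleton {F : Finset ℕ} {N m : ℕ} (hF : ∀ x ∈ F, x < m)
    (h : ∀ n, N ≤ n → ∀ x ∈ F, ∀ y ∈ F, level x = n → level y = n → x = y) :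
    F.card ≤ 2 ^ N + (Nat.log 2 m + 1) := by
  classical
  rw [← Finset.card_filter_add_card_filter_not (s := F) (fun x => level x < N)]
  refine Nat.add_le_add ?_ ?_
  · calc _ ≤ (Finset.range (2 ^ N)).card := by
          refine Finset.card_le_card fun x hx => ?_
          have h1 := (Finset.mem_filter.1 hx).2
          have := (Nat.log_lt_iff_lt_pow (by norm_num) (by omega)).1 h1
          exact Finset.mem_range.2 (by omega)
      _ = 2 ^ N := Finset.card_range _
  · calc _ ≤ (Finset.range (Nat.log 2 m + 1)).card := by
          refine Finset.card_le_card_of_injOn level ?_ ?_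
          · intro x hx
            have h1 := hF x (Finset.mem_filter.1 hx).1
            have : level x ≤ Nat.log 2 m := Nat.log_mono_right h1
            exact Finset.mem_coe.2 (Finset.mem_range.2 (by omega))
          · intro x hx y hy hxy
            have hx := Finset.mem_filter.1 hx
            have hy := Finset.mem_filter.1 hy
            exact h (level y) (by omega) x hx.1 y hy.1 hxy rfl
      _ = _ := Finset.card_range _

/-- A set has density 0 if its trace on each block has at most one element in almost every
level: for each `K`, all but the first `K` blocks together have density `2 ^ (-K)`, and the first
`K` blocks contribute `O(log m)` elements below `m`. -/
theorem hasDensityOne_compl {E : Set ℕ}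
    (hE : ∀ e, ∃ N, ∀ n, N ≤ n → ∀ x ∈ E, ∀ y ∈ E, block x = e → block y = e →
      level x = n → level y = n → x = y) : HasDensityOne Eᶜ := by
  classical
  choose N hN using hE
  let cnt : ℕ → ℕ := fun m => ((Finset.range m).filter (fun x => x ∈ E)).card
  have hcount : ∀ K m, cnt m ≤
      ∑ e ∈ Finset.range K, (2 ^ N e + (Nat.log 2 m + 1)) + m / 2 ^ K := by
    intro K m
    have hsub : (Finset.range m).filter (fun x => x ∈ E) ⊆
        (Finset.range K).biUnion
          (fun e => (Finset.range m).filter (fun x => x ∈ E ∧ block x = e)) ∪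
        (Finset.range m).filter (fun x => 2 ^ K ∣ x + 1) := by
      intro x hx
      obtain ⟨hxm, hxE⟩ := Finset.mem_filter.1 hx
      rw [Finset.mem_union]
      rcases lt_or_ge (block x) K with hb | hb
      · left
        exact Finset.mem_biUnion.2 ⟨block x, Finset.mem_range.2 hb,
          Finset.mem_filter.2 ⟨hxm, hxE, rfl⟩⟩
      · right
        exact Finset.mem_filter.2 ⟨hxm, (padicValNat_dvd_iff_le (by omega)).2 hb⟩
    refine (Finset.card_le_card hsub).trans ((Finset.card_union_le _ _).trans
      (Nat.add_le_add (Finset.card_biUnion_le.trans (Finset.sum_le_sum fun e _ => ?_)) ?_))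
    · refine card_le_of_subsingleton ?_ ?_
      · intro x hx
        exact Finset.mem_range.1 (Finset.mem_filter.1 hx).1
      · intro n hn x hx y hy hxn hyn
        obtain ⟨-, hxE, hxe⟩ := Finset.mem_filter.1 hx
        obtain ⟨-, hyE, hye⟩ := Finset.mem_filter.1 hy
        exact hN e n hn x hxE y hyE hxe hye hxn hyn
    · exact (Nat.card_multiples m (2 ^ K)).le
  have hlog : Tendsto (fun m : ℕ => (Nat.log 2 m : ℝ) / m) atTop (𝓝 0) := by
    have h1 : Tendsto (fun m : ℕ => (Real.log m / m) * (Real.log 2)⁻¹) atTop (𝓝 0) := by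
      have h2 : Tendsto (fun x : ℝ => Real.log x / x) atTop (𝓝 0) :=
        Real.isLittleO_log_id_atTop.tendsto_div_nhds_zero
      simpa using (h2.comp tendsto_natCast_atTop_atTop).mul_const (Real.log 2)⁻¹
    refine squeeze_zero (fun m => by positivity) (fun m => ?_) h1
    have h3 := Real.natLog_le_logb m 2
    calc (Nat.log 2 m : ℝ) / m ≤ Real.logb 2 m / m := by gcongr; exact_mod_cast h3
      _ = (Real.log m / m) * (Real.log 2)⁻¹ := by rw [Real.logb]; ring
  have hinv : Tendsto (fun m : ℕ => (1 : ℝ) / m) atTop (𝓝 0) :=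
    tendsto_one_div_atTop_nhds_zero_nat
  have hzero : Tendsto (fun m : ℕ => (cnt m : ℝ) / m) atTop (𝓝 0) := by
    rw [tendsto_order]
    refine ⟨fun a ha => Eventually.of_forall fun m => ha.trans_le (by positivity), fun ε hε => ?_⟩
    obtain ⟨K, hK⟩ := exists_pow_lt_of_lt_one hε (by norm_num : (1 / 2 : ℝ) < 1)
    have hlim : Tendsto (fun m : ℕ => (∑ e ∈ Finset.range K, ((2 : ℝ) ^ N e + 1)) * ((1 : ℝ) / m) +
        K * ((Nat.log 2 m : ℝ) / m) + (1 / 2) ^ K) atTop (𝓝 ((1 / 2) ^ K)) := by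
      simpa using ((hinv.const_mul (∑ e ∈ Finset.range K, ((2 : ℝ) ^ N e + 1))).add
        (hlog.const_mul (K : ℝ))).add_const ((1 / 2 : ℝ) ^ K)
    filter_upwards [hlim.eventually (gt_mem_nhds hK), eventually_gt_atTop 0] with m hm hm0
    refine lt_of_le_of_lt ?_ hm
    have hm0' : (0 : ℝ) < m := by exact_mod_cast hm0
    rw [div_le_iff₀ hm0']
    have h4 : (cnt m : ℝ) ≤ ((∑ e ∈ Finset.range K, (2 ^ N e + (Nat.log 2 m + 1)) +
        m / 2 ^ K : ℕ) : ℝ) := by exact_mod_cast hcount K m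
    have h5 : ((m / 2 ^ K : ℕ) : ℝ) ≤ (1 / 2) ^ K * m := by
      refine Nat.cast_div_le.trans (le_of_eq ?_)
      push_cast
      rw [one_div, inv_pow]
      ring
    have h6 : (∑ e ∈ Finset.range K, ((2 : ℝ) ^ N e + ((Nat.log 2 m : ℝ) + 1))) =
        (∑ e ∈ Finset.range K, ((2 : ℝ) ^ N e + 1)) + K * (Nat.log 2 m : ℝ) := by
      simp only [Finset.sum_add_distrib, Finset.sum_const, Finset.card_range, nsmul_eq_mul]
      ring
    push_cast at h4 h5
    rw [h6] at h4
    have h7 : ((∑ e ∈ Finset.range K, ((2 : ℝ) ^ N e + 1)) * ((1 : ℝ) / m) +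
        K * ((Nat.log 2 m : ℝ) / m) + (1 / 2) ^ K) * m =
        (∑ e ∈ Finset.range K, ((2 : ℝ) ^ N e + 1)) + K * (Nat.log 2 m : ℝ) + (1 / 2) ^ K * m := by
      field_simp
    rw [h7]
    linarith
  have hone : Tendsto (fun m : ℕ => 1 - (cnt m : ℝ) / m) atTop (𝓝 1) := by
    simpa using hzero.const_sub 1
  refine hone.congr' ?_
  filter_upwards [eventually_gt_atTop 0] with m hm
  have hm' : (m : ℝ) ≠ 0 := by positivity
  have h8 : (Eᶜ ∩ Set.Iio m) = ((Finset.range m).filter (fun x => ¬ x ∈ E) : Finset ℕ) := by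
    ext x
    simp [and_comm]
  have h9 := Finset.card_filter_add_card_filter_not (s := Finset.range m) (fun x => x ∈ E)
  rw [Finset.card_range] at h9
  rw [h8, Set.ncard_coe_finset, eq_div_iff hm', sub_mul, div_mul_cancel₀ _ hm', one_mul]
  have h10 : (cnt m : ℝ) + (((Finset.range m).filter (fun x => ¬ x ∈ E)).card : ℝ) = m := by
    exact_mod_cast h9
  linarith

/-! ### Enumerating the domains of partial recursive functions -/

open Nat.Partrec (Code)

/-- The number `k` codes the information that the `e`-th partial recursive function halts on some
element of block `e` and level `n` within a given number of steps. -/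
def isWitness (e n k : ℕ) : Bool :=
  block k.unpair.1 == e && (level k.unpair.1 == n &&
    (Code.evaln k.unpair.2 (Denumerable.ofNat Code e) k.unpair.1).isSome)

/-- The element of block `e` and level `n` that is found first when the domain of the
`e`-th partial recursive function is enumerated, if one is found before stage `s`. -/
def firstHit (e n : ℕ) : ℕ → Option ℕ
  | 0 => none
  | s + 1 =>
    firstHit e n s <|> (bif isWitness e n s then some s.unpair.1 else none)

theorem firstHit_mono {e n s s' x : ℕ} (hs : s ≤ s') (h : firstHit e n s = some x) :
    firstHit e n s' = some x := by
  induction s', hs using Nat.le_induction with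
  | base => exact h
  | succ s' _ ih => simp [firstHit, ih]

theorem firstHit_unique {e n s s' x y : ℕ} (h : firstHit e n s = some x)
    (h' : firstHit e n s' = some y) : x = y := by
  have h1 := firstHit_mono (le_max_left s s') h
  have h2 := firstHit_mono (le_max_right s s') h'
  exact Option.some.inj (h1.symm.trans h2)

theorem firstHit_spec {e n s x : ℕ} (h : firstHit e n s = some x) :
    block x = e ∧ level x = n ∧ (Code.eval (Denumerable.ofNat Code e) x).Dom := by
  induction s with
  | zero => simp [firstHit] at h
  | succ s ih =>
    rw [firstHit] at h
    cases h1 : firstHit e n s with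
    | some y =>
      rw [h1] at h ih
      exact ih (by simpa using h)
    | none =>
      rw [h1] at h
      cases hw : isWitness e n s with
      | false => simp [hw] at h
      | true =>
        have hx : s.unpair.1 = x := by simpa [hw] using h
        simp only [isWitness, hx, Bool.and_eq_true, beq_iff_eq] at hw
        refine ⟨hw.1, hw.2.1, ?_⟩
        obtain ⟨y, hy⟩ := Option.isSome_iff_exists.1 hw.2.2
        exact Part.dom_iff_mem.2 ⟨y, Code.evaln_sound hy⟩

theorem exists_firstHit_isSome {e n x : ℕ} (hb : block x = e) (hl : level x = n)
    (hd : (Code.eval (Denumerable.ofNat Code e) x).Dom) : ∃ s, (firstHit e n s).isSome = true := by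
  obtain ⟨y, hy⟩ := Part.dom_iff_mem.1 hd
  obtain ⟨t, ht⟩ := Code.evaln_complete.1 hy
  have hw : isWitness e n (Nat.pair x t) = true := by
    simp [isWitness, hb, hl, Option.isSome_iff_exists.2 ⟨y, ht⟩]
  refine ⟨Nat.pair x t + 1, ?_⟩
  rw [firstHit, hw]
  cases firstHit e n (Nat.pair x t) <;> simp

/-- The search on the binary tree for index `e`: the node reached at stage `m` is hit as soon as
an element of block `e` and level `m` is enumerated. -/
def indexStack (e : ℕ) : ℕ → List (Bool × ℕ) :=
  searchStack fun m s => (firstHit e m s).isSome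

theorem firstHit_isSome_mono (e m s s' : ℕ) (hs : s ≤ s') (h : (firstHit e m s).isSome = true) :
    (firstHit e m s').isSome = true := by
  obtain ⟨x, hx⟩ := Option.isSome_iff_exists.1 h
  exact Option.isSome_iff_exists.2 ⟨x, firstHit_mono hs hx⟩

theorem primrec_two_pow : Primrec fun n : ℕ => 2 ^ n := by
  refine (Primrec.nat_rec₁ 1 (f := fun _ y => 2 * y)
    (Primrec.nat_mul.comp (Primrec.const 2) Primrec.snd)).of_eq fun n => ?_
  induction n with
  | zero => rfl
  | succ n ih => simp only [ih, pow_succ]; ring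

theorem primrec_level : Primrec level := by
  have h : Primrec fun x : ℕ => Nat.findGreatest (fun k => 2 ^ k ≤ x + 1) (x + 1) := by
    refine Primrec.nat_findGreatest Primrec.succ ?_
    exact Primrec.nat_le.comp (primrec_two_pow.comp Primrec.snd) (Primrec.succ.comp Primrec.fst)
  refine h.of_eq fun x => ?_
  rw [Nat.findGreatest_eq_iff]
  refine ⟨Nat.log_le_self _ _, fun _ => Nat.pow_log_le_self 2 (by omega), fun k hk _ hc => ?_⟩
  have := Nat.le_log_of_pow_le (by norm_num) hc
  exact absurd this (not_le.2 hk)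

theorem primrec_block : Primrec block := by
  have h : Primrec fun x : ℕ => Nat.findGreatest (fun k => (x + 1) % 2 ^ k = 0) (x + 1) := by
    refine Primrec.nat_findGreatest Primrec.succ ?_
    exact Primrec.eq.comp (Primrec.nat_mod.comp (Primrec.succ.comp Primrec.fst)
      (primrec_two_pow.comp Primrec.snd)) (Primrec.const 0)
  refine h.of_eq fun x => ?_
  rw [Nat.findGreatest_eq_iff]
  refine ⟨(padicValNat_le_nat_log _).trans (Nat.log_le_self _ _),
    fun _ => Nat.mod_eq_zero_of_dvd pow_padicValNat_dvd, fun k hk _ hc => ?_⟩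
  have := (padicValNat_dvd_iff_le (by omega)).1 (Nat.dvd_of_mod_eq_zero hc)
  exact absurd this (not_le.2 hk)

theorem primrec_isWitness : Primrec fun p : (ℕ × ℕ) × ℕ => isWitness p.1.1 p.1.2 p.2 := by
  have hx : Primrec fun p : (ℕ × ℕ) × ℕ => p.2.unpair.1 :=
    Primrec.fst.comp (Primrec.unpair.comp Primrec.snd)
  have ht : Primrec fun p : (ℕ × ℕ) × ℕ => p.2.unpair.2 :=
    Primrec.snd.comp (Primrec.unpair.comp Primrec.snd)
  have he : Primrec fun p : (ℕ × ℕ) × ℕ => p.1.1 := Primrec.fst.comp Primrec.fst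
  have hn : Primrec fun p : (ℕ × ℕ) × ℕ => p.1.2 := Primrec.snd.comp Primrec.fst
  have ha : Primrec fun p : (ℕ × ℕ) × ℕ =>
      ((p.2.unpair.2, Denumerable.ofNat Code p.1.1), p.2.unpair.1) :=
    (ht.pair ((Primrec.ofNat Code).comp he)).pair hx
  have hc := Primrec.option_isSome.comp (Code.primrec_evaln.comp ha)
  have hb : Primrec fun p : (ℕ × ℕ) × ℕ => block p.2.unpair.1 == p.1.1 :=
    Primrec.beq.comp (primrec_block.comp hx) he
  have hl : Primrec fun p : (ℕ × ℕ) × ℕ => level p.2.unpair.1 == p.1.2 :=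
    Primrec.beq.comp (primrec_level.comp hx) hn
  have h := Primrec.and.comp hb (Primrec.and.comp hl hc)
  refine h.of_eq fun p => ?_
  rw [isWitness]

theorem primrec_firstHit : Primrec fun p : (ℕ × ℕ) × ℕ => firstHit p.1.1 p.1.2 p.2 := by
  have hstep : Primrec₂ fun (p : (ℕ × ℕ) × ℕ) (q : ℕ × Option ℕ) =>
      (q.2 <|> (bif isWitness p.1.1 p.1.2 q.1 then some q.1.unpair.1 else none) : Option ℕ) := by
    have ha : Primrec fun a : ((ℕ × ℕ) × ℕ) × ℕ × Option ℕ => (a.1.1, a.2.1) :=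
      (Primrec.fst.comp Primrec.fst).pair (Primrec.fst.comp Primrec.snd)
    have hw := primrec_isWitness.comp ha
    have hx : Primrec fun a : ((ℕ × ℕ) × ℕ) × ℕ × Option ℕ => some a.2.1.unpair.1 :=
      Primrec.option_some.comp
        (Primrec.fst.comp (Primrec.unpair.comp (Primrec.fst.comp Primrec.snd)))
    exact Primrec.option_orElse.comp (Primrec.snd.comp Primrec.snd)
      (Primrec.cond hw hx (Primrec.const none))
  refine (Primrec.nat_rec' Primrec.snd (Primrec.const none) hstep).of_eq fun p => ?_
  obtain ⟨⟨e, n⟩, s⟩ := p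
  induction s with
  | zero => rfl
  | succ s ih => simp only [firstHit] at ih ⊢; rw [ih]

theorem primrec_any {α β : Type*} [Primcodable α] [Primcodable β] {f : α → List β}
    {p : α → β → Bool} (hf : Primrec f) (hp : Primrec₂ p) :
    Primrec fun a => (f a).any (p a) := by
  have h : Primrec₂ fun (a : α) (q : β × Bool) => p a q.1 || q.2 :=
    Primrec.or.comp (hp.comp Primrec.fst (Primrec.fst.comp Primrec.snd))
      (Primrec.snd.comp Primrec.snd)
  refine (Primrec.list_foldr hf (Primrec.const false) h).of_eq fun a => ?_
  induction f a with
  | nil => rfl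
  | cons b l ih => rw [List.foldr_cons, ih, List.any_cons]

theorem primrec_beq {α β : Type*} [Primcodable α] [Primcodable β] [BEq β] [LawfulBEq β]
    {f g : α → β} (hf : Primrec f) (hg : Primrec g) : Primrec fun a => f a == g a := by
  classical
  refine (Primrec.eq.decide.comp hf hg).of_eq fun a => ?_
  rw [Bool.eq_iff_iff]
  simp

theorem primrec_backtrack : Primrec₂ backtrack := by
  have h : Primrec₂ fun (a : ℕ × List (Bool × ℕ))
      (q : (Bool × ℕ) × List (Bool × ℕ) × List (Bool × ℕ)) =>
      bif q.1.1 then q.2.2 else (true, a.1) :: q.2.1 := by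
    refine Primrec.cond (Primrec.fst.comp (Primrec.fst.comp Primrec.snd))
      (Primrec.snd.comp (Primrec.snd.comp Primrec.snd)) (Primrec.list_cons.comp ?_ ?_)
    · exact (Primrec.const true).pair (Primrec.fst.comp Primrec.fst)
    · exact Primrec.fst.comp (Primrec.snd.comp Primrec.snd)
  have h0 : Primrec fun a : ℕ × List (Bool × ℕ) => [(true, a.1)] :=
    Primrec.list_cons.comp ((Primrec.const true).pair Primrec.fst) (Primrec.const [])
  refine (Primrec.list_rec Primrec.snd h0 h).of_eq fun a => ?_
  obtain ⟨k, r⟩ := a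
  induction r with
  | nil => rfl
  | cons p r ih => simp only [backtrack] at ih ⊢; rw [← ih]

theorem primrec_indexStack : Primrec₂ indexStack := by
  have hstep : Primrec₂ fun (p : ℕ × ℕ) (q : ℕ × List (Bool × ℕ)) =>
      bif q.2.any (fun z => (firstHit p.1 z.2 q.1).isSome) then backtrack (q.1 + 1) q.2
      else (false, q.1 + 1) :: q.2 := by
    have hsucc : Primrec fun a : (ℕ × ℕ) × ℕ × List (Bool × ℕ) => a.2.1 + 1 :=
      Primrec.succ.comp (Primrec.fst.comp Primrec.snd)
    have hl : Primrec fun a : (ℕ × ℕ) × ℕ × List (Bool × ℕ) => a.2.2 :=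
      Primrec.snd.comp Primrec.snd
    refine Primrec.cond (primrec_any hl ?_) (primrec_backtrack.comp hsucc hl)
      (Primrec.list_cons.comp ((Primrec.const false).pair hsucc) hl)
    have ha : Primrec fun a : ((ℕ × ℕ) × ℕ × List (Bool × ℕ)) × Bool × ℕ =>
        ((a.1.1.1, a.2.2), a.1.2.1) :=
      ((Primrec.fst.comp (Primrec.fst.comp Primrec.fst)).pair
        (Primrec.snd.comp Primrec.snd)).pair (Primrec.fst.comp (Primrec.snd.comp Primrec.fst))
    exact Primrec.option_isSome.comp (primrec_firstHit.comp ha)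
  refine (Primrec.nat_rec' Primrec.snd (Primrec.const [(true, 0)]) hstep).of_eq fun p => ?_
  obtain ⟨e, n⟩ := p
  induction n with
  | zero => rfl
  | succ n ih => simp only [indexStack, searchStack] at ih ⊢; rw [ih]

/-! ### Closure properties of relative computability -/

section
variable {O : Set (ℕ →. ℕ)}

theorem ComputableIn.nat_comp {f g : ℕ → ℕ} (hf : ComputableIn O f) (hg : ComputableIn O g) :
    ComputableIn O fun n => f (g n) := by
  have h1 := RecursiveIn.iff_nat.1 hf
  have h2 := RecursiveIn.iff_nat.1 hg
  exact RecursiveIn.iff_nat.2 ((h1.comp h2).of_eq fun n => by simp)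

theorem ComputableIn.nat_pair {f g : ℕ → ℕ} (hf : ComputableIn O f) (hg : ComputableIn O g) :
    ComputableIn O fun n => Nat.pair (f n) (g n) := by
  have h1 := RecursiveIn.iff_nat.1 hf
  have h2 := RecursiveIn.iff_nat.1 hg
  exact RecursiveIn.iff_nat.2 ((h1.pair h2).of_eq fun n => by simp [Seq.seq])

/-- Unbounded search for a computable property of one value of a function computable in `O`. -/
theorem ComputableIn.rfind {f : ℕ → ℕ} (hf : ComputableIn O f) {u : ℕ → ℕ → ℕ}
    (hu : Computable₂ u) {T : ℕ → ℕ → ℕ → Bool}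
    (hT : Computable fun p : (ℕ × ℕ) × ℕ => T p.1.1 p.1.2 p.2) :
    RecursiveIn O fun x => Nat.rfind fun j => Part.some (T x j (f (u x j))) := by
  have hu' : Computable fun q : ℕ => u q.unpair.1 q.unpair.2 :=
    hu.comp (Computable.fst.comp Computable.unpair) (Computable.snd.comp Computable.unpair)
  have h1 : ComputableIn O fun q : ℕ => Nat.pair q (f (u q.unpair.1 q.unpair.2)) :=
    ComputableIn.nat_pair (Computable.id.computableIn) (hf.nat_comp hu'.computableIn)
  have ha : Computable fun r : ℕ =>
      ((r.unpair.1.unpair.1, r.unpair.1.unpair.2), r.unpair.2) := by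
    have h2 : Computable fun r : ℕ => r.unpair.1.unpair :=
      Computable.unpair.comp (Computable.fst.comp Computable.unpair)
    exact Computable.pair h2 (Computable.snd.comp Computable.unpair)
  have h3 := Computable.cond (hT.comp ha) (Computable.const 0) (Computable.const 1)
  have h4 := RecursiveIn.iff_nat.1 (ComputableIn.nat_comp h3.computableIn h1)
  refine RecursiveIn.iff_nat.2 (h4.rfind.of_eq fun x => ?_)
  congr 1
  funext j
  simp only [Part.map_eq_map, Part.map_some, Nat.unpair_pair]
  congr 1
  cases T x j (f (u x j)) <;> simp

theorem ComputableIn.of_rfind {f : ℕ → ℕ} (hf : ComputableIn O f) {u : ℕ → ℕ → ℕ}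
    (hu : Computable₂ u) {T : ℕ → ℕ → ℕ → Bool}
    (hT : Computable fun p : (ℕ × ℕ) × ℕ => T p.1.1 p.1.2 p.2)
    (h : ∀ x, ∃ j, T x j (f (u x j)) = true) :
    ComputableIn O fun x => Nat.find (h x) := by
  refine RecursiveIn.of_eq_tot (hf.rfind hu hT) fun x => ?_
  refine Nat.mem_rfind.2 ⟨?_, fun {m} hm => ?_⟩
  · simpa using (Nat.find_spec (h x)).symm
  · simpa using (Nat.find_min (h x) hm)

/-- A set that is recursively enumerable in `O` is the domain of a function recursive in `O` that
vanishes wherever it is defined. -/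
theorem ComputableIn.exists_dom_eq {f : ℕ → ℕ} (hf : ComputableIn O f) {u : ℕ → ℕ → ℕ}
    (hu : Computable₂ u) {T : ℕ → ℕ → ℕ → Bool}
    (hT : Computable fun p : (ℕ × ℕ) × ℕ => T p.1.1 p.1.2 p.2) :
    ∃ φ : ℕ →. ℕ, RecursiveIn O φ ∧ φ.Dom = {x | ∃ j, T x j (f (u x j)) = true} ∧
      ∀ x, ∀ b ∈ φ x, b = 0 := by
  have h1 := RecursiveIn.iff_nat.1 (hf.rfind hu hT)
  refine ⟨_, RecursiveIn.iff_nat.2 (Nat.RecursiveIn.comp Nat.RecursiveIn.zero h1), ?_, ?_⟩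
  · ext x
    have h2 : (Nat.rfind fun j => Part.some (T x j (f (u x j)))).Dom ↔
        ∃ j, T x j (f (u x j)) = true := by
      refine Nat.rfind_dom'.trans ⟨fun ⟨j, hj, _⟩ => ⟨j, (Part.mem_some_iff.1 hj).symm⟩, ?_⟩
      rintro ⟨j, hj⟩
      exact ⟨j, Part.mem_some_iff.2 hj.symm, fun _ => trivial⟩
    exact Iff.trans ⟨fun h => h.1, fun h => ⟨h, trivial⟩⟩ h2
  · intro x b hb
    obtain ⟨a, -, ha⟩ := Part.mem_bind_iff.1 hb
    exact Part.mem_some_iff.1 ha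

/-- The running maximum of a function. -/
def runningMax (f : ℕ → ℕ) : ℕ → ℕ
  | 0 => f 0
  | n + 1 => max (runningMax f n) (f (n + 1))

theorem le_runningMax (f : ℕ → ℕ) (n : ℕ) : f n ≤ runningMax f n := by
  cases n with
  | zero => exact le_rfl
  | succ n => exact le_max_right _ _

theorem monotone_runningMax (f : ℕ → ℕ) : Monotone (runningMax f) :=
  monotone_nat_of_le_succ fun _ => le_max_left _ _

theorem ComputableIn.runningMax {f : ℕ → ℕ} (hf : ComputableIn O f) :
    ComputableIn O (runningMax f) := by
  have hmax : Computable fun q : ℕ => max q.unpair.1 q.unpair.2 :=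
    (Primrec.nat_max.comp (Primrec.fst.comp Primrec.unpair)
      (Primrec.snd.comp Primrec.unpair)).to_comp
  have hi : Computable fun q : ℕ => q.unpair.2.unpair.2 :=
    Computable.snd.comp (Computable.unpair.comp (Computable.snd.comp Computable.unpair))
  have hy : Computable fun q : ℕ => q.unpair.2.unpair.1 + 1 :=
    Computable.succ.comp
      (Computable.fst.comp (Computable.unpair.comp (Computable.snd.comp Computable.unpair)))
  have h1 : ComputableIn O fun q : ℕ =>
      max (Nat.pair q.unpair.2.unpair.2 (f (q.unpair.2.unpair.1 + 1))).unpair.1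
        (Nat.pair q.unpair.2.unpair.2 (f (q.unpair.2.unpair.1 + 1))).unpair.2 :=
    ComputableIn.nat_comp hmax.computableIn
      (ComputableIn.nat_pair hi.computableIn (hf.nat_comp hy.computableIn))
  have h0 : ComputableIn O fun _ : ℕ => f 0 := hf.nat_comp (Computable.const 0).computableIn
  have h2 := (RecursiveIn.iff_nat.1 h0).prec (RecursiveIn.iff_nat.1 h1)
  have h3 : ComputableIn O fun n : ℕ => Nat.pair 0 n :=
    (Primrec₂.natPair.comp (Primrec.const 0) Primrec.id).to_comp.computableIn
  refine RecursiveIn.iff_nat.2 ((h2.comp (RecursiveIn.iff_nat.1 h3)).of_eq fun n => ?_)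
  simp only [Part.bind_eq_bind, Part.bind_some, Nat.unpair_pair]
  induction n with
  | zero => rfl
  | succ n ih =>
    simp only [ih, Part.bind_some]
    rfl

end

open Classical in
/-- The characteristic function of a real with values in `Bool`. -/
noncomputable def boolChar (Z : Set ℕ) (n : ℕ) : Bool := decide (n ∈ Z)

theorem computableIn_boolChar (Z : Set ℕ) :
    ComputableIn {charFun Z} fun n => (boolChar Z n).toNat := by
  refine (RecursiveIn.oracle (charFun Z) (Set.mem_singleton _)).of_eq fun n => ?_
  simp only [charFun, boolChar]
  by_cases h : n ∈ Z <;> simp [h]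

theorem isRecursive_of_computable {Z : Set ℕ} (h : Computable (boolChar Z)) : IsRecursive Z := by
  classical
  refine ⟨inferInstance, h.of_eq fun n => ?_⟩
  simp [boolChar]

/-! ### Limit computable reals and functions not dominated by computable ones -/

/-- A real is limit computable if it is the pointwise limit of a computable sequence of reals. -/
def IsLimitComputable (Z : Set ℕ) : Prop :=
  ∃ g : ℕ → ℕ → Bool, Computable₂ g ∧ ∀ k, ∀ᶠ s in atTop, g k s = boolChar Z k

/-- A function is dominated if it lies below some computable function everywhere. -/
def IsDominated (f : ℕ → ℕ) : Prop :=
  ∃ h : ℕ → ℕ, Computable h ∧ ∀ n, f n ≤ h n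

/-- Bounded universal quantification over a Boolean-valued function. -/
def allBelow (p : ℕ → Bool) (n : ℕ) : Bool :=
  Nat.rec true (fun s ih => ih && p s) n

theorem allBelow_eq_true {p : ℕ → Bool} {n : ℕ} :
    allBelow p n = true ↔ ∀ s, s < n → p s = true := by
  induction n with
  | zero => simp [allBelow]
  | succ n ih =>
    have h : allBelow p (n + 1) = (allBelow p n && p n) := rfl
    rw [h, Bool.and_eq_true, ih, Nat.forall_lt_succ_right]

theorem computable_allBelow {α : Type*} [Primcodable α] {p : α → ℕ → Bool} {f : α → ℕ}
    (hp : Computable₂ p) (hf : Computable f) : Computable fun a => allBelow (p a) (f a) := by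
  refine Computable.nat_rec hf (Computable.const true)
    (h := fun a (q : ℕ × Bool) => q.2 && p a q.1) ?_
  exact Primrec.and.to_comp.comp (Computable.snd.comp Computable.snd)
    (hp.comp Computable.fst (Computable.fst.comp Computable.snd))

theorem computable_le {α : Type*} [Primcodable α] {f g : α → ℕ} (hf : Computable f)
    (hg : Computable g) : Computable fun a => decide (f a ≤ g a) :=
  Primrec.nat_le.decide.to_comp.comp hf hg

theorem computable_lt {α : Type*} [Primcodable α] {f g : α → ℕ} (hf : Computable f)
    (hg : Computable g) : Computable fun a => decide (f a < g a) :=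
  Primrec.nat_lt.decide.to_comp.comp hf hg

theorem computable_beq {α β : Type*} [Primcodable α] [Primcodable β] [DecidableEq β]
    {f g : α → β} (hf : Computable f) (hg : Computable g) : Computable fun a => f a == g a :=
  Primrec.beq.to_comp.comp hf hg

theorem computable_find {p : ℕ → ℕ → Bool} (hp : Computable₂ p) (h : ∀ x, ∃ j, p x j = true) :
    Computable fun x => Nat.find (h x) := by
  refine (Partrec.rfind hp.partrec₂).of_eq_tot fun x => Nat.mem_rfind.2 ⟨?_, fun {m} hm => ?_⟩
  · simpa using (Nat.find_spec (h x)).symm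
  · simpa using Nat.find_min (h x) hm

/-- A nonrecursive limit computable real computes a function that is not dominated by any
computable function.  The function finds stages, past a given one, at which the
approximation is correct at a given place; a computable bound on such stages would yield stages
at which correctness can be recognised by the constancy of the approximation on an interval. -/
theorem exists_not_isDominated {Z : Set ℕ} (hlim : IsLimitComputable Z) (hrec : ¬ IsRecursive Z) :
    ∃ f : ℕ → ℕ, ComputableIn {charFun Z} f ∧ Monotone f ∧ ¬ IsDominated f := by
  obtain ⟨g, hg, hlim⟩ := hlim
  let T : ℕ → ℕ → ℕ → Bool := fun p s c =>
    decide (p.unpair.1 ≤ s) && (g p.unpair.2 s == (c == 1))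
  have hT : Computable fun p : (ℕ × ℕ) × ℕ => T p.1.1 p.1.2 p.2 := by
    have h1 : Computable fun p : (ℕ × ℕ) × ℕ => p.1.1.unpair :=
      Computable.unpair.comp (Computable.fst.comp Computable.fst)
    have hs : Computable fun p : (ℕ × ℕ) × ℕ => p.1.2 := Computable.snd.comp Computable.fst
    exact Primrec.and.to_comp.comp (computable_le (Computable.fst.comp h1) hs)
      (computable_beq (hg.comp (Computable.snd.comp h1) hs)
        (computable_beq Computable.snd (Computable.const 1)))
  have hu : Computable₂ fun (p : ℕ) (_ : ℕ) => p.unpair.2 :=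
    (Computable.snd.comp Computable.unpair).comp Computable.fst
  have hTiff : ∀ p s, T p s (boolChar Z p.unpair.2).toNat = true ↔
      p.unpair.1 ≤ s ∧ g p.unpair.2 s = boolChar Z p.unpair.2 := by
    intro p s
    simp only [T, Bool.and_eq_true, decide_eq_true_eq, beq_iff_eq]
    cases boolChar Z p.unpair.2 <;> simp
  have hex : ∀ p, ∃ s, T p s (boolChar Z p.unpair.2).toNat = true := by
    intro p
    obtain ⟨s, hs, hs'⟩ := ((hlim p.unpair.2).and (eventually_ge_atTop p.unpair.1)).exists
    exact ⟨s, (hTiff p s).2 ⟨hs', hs⟩⟩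
  have hf := ComputableIn.of_rfind (computableIn_boolChar Z) hu hT hex
  refine ⟨_, hf.runningMax, monotone_runningMax _, ?_⟩
  rintro ⟨h, hh, hle⟩
  apply hrec
  apply isRecursive_of_computable
  let K : ℕ → ℕ → Bool := fun k n =>
    allBelow (fun s => decide (s < n) || g k s == g k n) (h (Nat.pair n k) + 1)
  have hK : Computable₂ K := by
    have hp : Computable₂ fun (a : ℕ × ℕ) (s : ℕ) => decide (s < a.2) || g a.1 s == g a.1 a.2 := by
      have hk : Computable fun b : (ℕ × ℕ) × ℕ => b.1.1 := Computable.fst.comp Computable.fst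
      have hn : Computable fun b : (ℕ × ℕ) × ℕ => b.1.2 := Computable.snd.comp Computable.fst
      exact Primrec.or.to_comp.comp (computable_lt Computable.snd hn)
        (computable_beq (hg.comp hk Computable.snd) (hg.comp hk hn))
    have hb : Computable fun a : ℕ × ℕ => h (Nat.pair a.2 a.1) + 1 :=
      Computable.succ.comp (hh.comp (Primrec₂.natPair.to_comp.comp Computable.snd Computable.fst))
    exact computable_allBelow hp hb
  have hKex : ∀ k, ∃ n, K k n = true := by
    intro k
    obtain ⟨n, hn⟩ := eventually_atTop.1 (hlim k)
    refine ⟨n, allBelow_eq_true.2 fun s _ => ?_⟩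
    rcases lt_or_ge s n with h1 | h1
    · simp [h1]
    · simp [hn s h1, hn n le_rfl]
  have hval : ∀ k n, K k n = true → g k n = boolChar Z k := by
    intro k n hkn
    have h1 := (hTiff (Nat.pair n k) _).1 (Nat.find_spec (hex (Nat.pair n k)))
    have h2 := (le_runningMax _ _).trans (hle (Nat.pair n k))
    have h3 := allBelow_eq_true.1 hkn _ (Nat.lt_succ_of_le h2)
    simp only [Nat.unpair_pair] at h1 h3
    rw [Bool.or_eq_true] at h3
    rcases h3 with h3 | h3
    · have := of_decide_eq_true h3
      omega
    · rw [← beq_iff_eq.1 h3]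
      exact h1.2
  exact (hg.comp Computable.id (computable_find hK hKex)).of_eq
    fun k => hval k _ (Nat.find_spec (hKex k))

/-- Two undominated functions can be replaced by functions whose minimum is undominated.  If a
computable `h` bounds `min f g`, then `g` is replaced by its value at the next argument at which
it exceeds `h`. -/
theorem exists_min_not_isDominated {O : Set (ℕ →. ℕ)} {f g : ℕ → ℕ}
    (hgO : ComputableIn O g) (hf : Monotone f) (hg : Monotone g) (hfd : ¬ IsDominated f)
    (hgd : ¬ IsDominated g) :
    ∃ g' : ℕ → ℕ, ComputableIn O g' ∧ Monotone g' ∧ ¬ IsDominated fun n => min (f n) (g' n) := by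
  by_cases hd : IsDominated fun n => min (f n) (g n)
  swap
  · exact ⟨g, hgO, hg, hd⟩
  obtain ⟨h, hh, hmin⟩ := hd
  let T : ℕ → ℕ → ℕ → Bool := fun n b c => decide (n ≤ b) && decide (h b < c)
  have hT : Computable fun p : (ℕ × ℕ) × ℕ => T p.1.1 p.1.2 p.2 := by
    have hs : Computable fun p : (ℕ × ℕ) × ℕ => p.1.2 := Computable.snd.comp Computable.fst
    exact Primrec.and.to_comp.comp (computable_le (Computable.fst.comp Computable.fst) hs)
      (computable_lt (hh.comp hs) Computable.snd)
  have hTiff : ∀ n b, T n b (g b) = true ↔ n ≤ b ∧ h b < g b := by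
    intro n b
    simp [T]
  have hex : ∀ n, ∃ b, T n b (g b) = true := by
    intro n
    by_contra hc
    push Not at hc
    refine hgd ⟨fun m => max (h m) (g n),
      Primrec.nat_max.to_comp.comp hh (Computable.const (g n)), fun m => ?_⟩
    rcases le_total m n with hmn | hmn
    · exact (hg hmn).trans (le_max_right _ _)
    · refine le_trans ?_ (le_max_left _ _)
      by_contra hlt
      exact hc m ((hTiff n m).2 ⟨hmn, not_le.1 hlt⟩)
  have hb := ComputableIn.of_rfind hgO (u := fun _ b => b) Computable.snd hT hex
  refine ⟨_, hgO.nat_comp hb, ?_, ?_⟩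
  · intro n n' hn
    refine hg (Nat.find_min' _ ?_)
    have := (hTiff _ _).1 (Nat.find_spec (hex n'))
    exact (hTiff _ _).2 ⟨hn.trans this.1, this.2⟩
  · rintro ⟨H, hH, hle⟩
    refine hfd ⟨H, hH, fun n => ?_⟩
    by_contra hlt
    have h1 := (hTiff _ _).1 (Nat.find_spec (hex n))
    have h2 := hle n
    simp only at h2
    generalize Nat.find (hex n) = b at h1 h2
    have h3 := hmin b
    have h4 := hf h1.1
    simp only at h3
    rcases min_le_iff.1 h2 with h5 | h5
    · exact hlt h5
    · rcases min_le_iff.1 h3 with h6 | h6 <;> omega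

/-! ### Sparse sets that meet every recursively enumerable set of density 1 -/

/-- `E` is negligible relative to `Z`: its complement has density 1 and is recursively enumerable
in `Z`, as witnessed by a partial function that takes only the value `0`. -/
def IsNegligibleFrom (Z E : Set ℕ) : Prop :=
  HasDensityOne Eᶜ ∧
    ∃ φ : ℕ →. ℕ, RecursiveIn {charFun Z} φ ∧ φ.Dom = Eᶜ ∧ ∀ x, ∀ b ∈ φ x, b = 0

/-- The set of all `x` that are found to be the first enumerated element of their block and level
within `f (level x)` steps. -/
def boundedHits (f : ℕ → ℕ) : Set ℕ :=
  {x | firstHit (block x) (level x) (f (level x)) = some x}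

/-- The set of all `x` such that the node reached at stage `level x` agrees with `Z` and, at each
later stage, either `x` is known to be the first enumerated element of its block and level, or no
such element has been found and the node is still on the stack. -/
def pendingHits (i : ℕ) (Z : Set ℕ) : Set ℕ :=
  {x | AgreesOn i (boolChar Z) (indexStack (block x) (level x)) ∧
    ∀ s, level x ≤ s → firstHit (block x) (level x) s = some x ∨
      (firstHit (block x) (level x) s = none ∧
        (indexStack (block x) s).any (fun p => p.2 == level x) = true)}

theorem isNegligibleFrom_boundedHits {Z : Set ℕ} {f : ℕ → ℕ} (hf : ComputableIn {charFun Z} f) :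
    IsNegligibleFrom Z (boundedHits f) := by
  constructor
  · refine hasDensityOne_compl fun e => ⟨0, fun n _ x hx y hy hxe hye hxn hyn => ?_⟩
    simp only [boundedHits, Set.mem_ofPred_eq] at hx hy
    rw [hxe, hxn] at hx
    rw [hye, hyn] at hy
    exact firstHit_unique hx hy
  · let T : ℕ → ℕ → ℕ → Bool := fun x _ c => !(firstHit (block x) (level x) c == some x)
    have hT : Computable fun p : (ℕ × ℕ) × ℕ => T p.1.1 p.1.2 p.2 := by
      have hx : Primrec fun p : (ℕ × ℕ) × ℕ => p.1.1 := Primrec.fst.comp Primrec.fst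
      have ha : Primrec fun p : (ℕ × ℕ) × ℕ => ((block p.1.1, level p.1.1), p.2) :=
        ((primrec_block.comp hx).pair (primrec_level.comp hx)).pair Primrec.snd
      have h1 := primrec_firstHit.comp ha
      exact (Primrec.not.comp (primrec_beq h1 (Primrec.option_some.comp hx))).to_comp
    have hu : Computable₂ fun (x : ℕ) (_ : ℕ) => level x :=
      primrec_level.to_comp.comp Computable.fst
    obtain ⟨φ, hφ, hdom, h0⟩ := hf.exists_dom_eq hu hT
    refine ⟨φ, hφ, ?_, h0⟩
    rw [hdom]
    ext x
    simp [boundedHits, T]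

theorem primrec_direction : Primrec₂ direction := by
  have h1 : Primrec₂ fun (r : List (Bool × ℕ)) (q : ℕ) => r.reverse[q]? :=
    Primrec.list_getElem?.comp (Primrec.list_reverse.comp Primrec.fst) Primrec.snd
  exact Primrec.option_map h1 (Primrec.fst.comp Primrec.snd)

/-- If `Z` is not limit computable, only finitely many nodes that agree with `Z` stay on the stack
forever, and all other levels contribute at most one element to `pendingHits i Z`. -/
theorem hasDensityOne_compl_pendingHits {Z : Set ℕ} (i : ℕ) (hZ : ¬ IsLimitComputable Z) :
    HasDensityOne (pendingHits i Z)ᶜ := by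
  refine hasDensityOne_compl fun e => ?_
  by_contra hc
  push Not at hc
  have hperm : ∀ N, ∃ n, N ≤ n ∧ AgreesOn i (boolChar Z) (indexStack e n) ∧
      ∀ m, n ≤ m → indexStack e n <:+ indexStack e m := by
    intro N
    obtain ⟨n, hn, x, hx, y, hy, hxe, hye, hxn, hyn, hxy⟩ := hc N
    obtain ⟨hxa, hxs⟩ := hx
    obtain ⟨-, hys⟩ := hy
    rw [hxe, hxn] at hxa hxs
    rw [hye, hyn] at hys
    refine ⟨n, hn, hxa, fun m hm => ?_⟩
    rcases hxs m hm with h1 | ⟨-, h1⟩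
    · rcases hys m hm with h2 | ⟨h2, -⟩
      · exact absurd (firstHit_unique h1 h2) hxy
      · simp [h1] at h2
    · exact any_stamp_iff.1 h1
  refine hZ ⟨fun k s => direction (indexStack e s) (2 * k + 1 + i) == some true, ?_, fun k => ?_⟩
  · have hq : Primrec fun p : ℕ × ℕ => 2 * p.1 + 1 + i :=
      Primrec.nat_add.comp (Primrec.succ.comp (Primrec.nat_mul.comp (Primrec.const 2) Primrec.fst))
        (Primrec.const i)
    have hs : Primrec fun p : ℕ × ℕ => indexStack e p.2 :=
      primrec_indexStack.comp (Primrec.const e) Primrec.snd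
    exact (primrec_beq (primrec_direction.comp hs hq) (Primrec.const (some true))).to_comp
  · filter_upwards [eventually_direction_eq hperm k] with s hs
    rw [indexStack, hs]
    cases boolChar Z k <;> rfl

theorem isNegligibleFrom_pendingHits {Z : Set ℕ} (i : ℕ) (hZ : ¬ IsLimitComputable Z) :
    IsNegligibleFrom Z (pendingHits i Z) := by
  refine ⟨hasDensityOne_compl_pendingHits i hZ, ?_⟩
  let T : ℕ → ℕ → ℕ → Bool := fun x j c =>
    (direction (indexStack (block x) (level x)) (2 * j + 1 + i) == some (!(c == 1))) ||
      (decide (level x ≤ j) && !((firstHit (block x) (level x) j == some x) ||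
        ((firstHit (block x) (level x) j == none) &&
          (indexStack (block x) j).any (fun p => p.2 == level x))))
  have hT : Computable fun p : (ℕ × ℕ) × ℕ => T p.1.1 p.1.2 p.2 := by
    have hx : Primrec fun p : (ℕ × ℕ) × ℕ => p.1.1 := Primrec.fst.comp Primrec.fst
    have hj : Primrec fun p : (ℕ × ℕ) × ℕ => p.1.2 := Primrec.snd.comp Primrec.fst
    have hb := primrec_block.comp hx
    have hl := primrec_level.comp hx
    have hq : Primrec fun p : (ℕ × ℕ) × ℕ => 2 * p.1.2 + 1 + i :=
      Primrec.nat_add.comp (Primrec.succ.comp (Primrec.nat_mul.comp (Primrec.const 2) hj))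
        (Primrec.const i)
    have hc : Primrec fun p : (ℕ × ℕ) × ℕ => some (!(p.2 == 1)) :=
      Primrec.option_some.comp
        (Primrec.not.comp (primrec_beq Primrec.snd (Primrec.const 1)))
    have hdir := primrec_beq (primrec_direction.comp (primrec_indexStack.comp hb hl) hq) hc
    have hfirst := primrec_firstHit.comp ((hb.pair hl).pair hj)
    have hsome := primrec_beq hfirst (Primrec.option_some.comp hx)
    have hnone := primrec_beq hfirst (Primrec.const none)
    have hstamp : Primrec₂ fun (p : (ℕ × ℕ) × ℕ) (z : Bool × ℕ) => z.2 == level p.1.1 :=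
      primrec_beq (Primrec.snd.comp Primrec.snd) (hl.comp Primrec.fst)
    have hany := primrec_any (primrec_indexStack.comp hb hj) hstamp
    have hle := Primrec.nat_le.decide.comp hl hj
    exact (Primrec.or.comp hdir (Primrec.and.comp hle
      (Primrec.not.comp (Primrec.or.comp hsome (Primrec.and.comp hnone hany))))).to_comp
  obtain ⟨φ, hφ, hdom, h0⟩ := (computableIn_boolChar Z).exists_dom_eq
    (u := fun _ j => j) Computable.snd hT
  refine ⟨φ, hφ, ?_, h0⟩
  rw [hdom]
  ext x
  have hcode : ∀ j, (!((boolChar Z j).toNat == 1)) = !boolChar Z j := by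
    intro j
    cases boolChar Z j <;> rfl
  simp only [Set.mem_ofPred_eq, T, pendingHits, Set.mem_compl_iff, AgreesOn, not_and_or, not_forall,
    hcode, Bool.or_eq_true, Bool.and_eq_true, Bool.not_eq_true', beq_iff_eq, decide_eq_true_eq]
  rw [exists_or]
  refine or_congr (exists_congr fun k => ?_) (exists_congr fun s => ?_)
  · constructor
    · intro h
      refine ⟨_, h, ?_⟩
      cases boolChar Z k <;> simp
    · rintro ⟨b, h, hb⟩
      rw [h]
      cases b <;> cases h2 : boolChar Z k <;> simp_all
  · rw [exists_prop, ← not_iff_not]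
    simp only [not_and, not_not, Bool.not_eq_false, Bool.or_eq_true, Bool.and_eq_true, beq_iff_eq]

/-- An element that is found while its node is on the stack is pending for every real which the
node agrees with. -/
theorem mem_pendingHits {i e m s x : ℕ} {Z : Set ℕ} (hx : firstHit e m s = some x)
    (hs : indexStack e m <:+ indexStack e s) (ha : AgreesOn i (boolChar Z) (indexStack e m)) :
    x ∈ pendingHits i Z := by
  obtain ⟨hb, hl, -⟩ := firstHit_spec hx
  subst hb hl
  refine ⟨ha, fun s' hs' => ?_⟩
  rcases le_total s s' with h | h
  · exact Or.inl (firstHit_mono h hx)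
  · cases h1 : firstHit (block x) (level x) s' with
    | some y => exact Or.inl (by rw [firstHit_unique h1 hx])
    | none => exact Or.inr ⟨rfl, any_stamp_iff.2 (searchStack_suffix_of_le hs hs' h)⟩

theorem exists_restart_of_hasDensityOne {c : Code} (hc : HasDensityOne (Code.eval c).Dom) (N : ℕ) :
    ∃ t, N < t ∧ indexStack (Encodable.encode c) t = [(true, t)] := by
  obtain ⟨N₀, h⟩ := exists_block_level_of_hasDensityOne hc (Encodable.encode c)
  refine exists_restart (firstHit_isSome_mono _) (N₀ := N₀) (fun n hn => ?_) N
  obtain ⟨x, hx, hb, hl⟩ := h n hn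
  exact exists_firstHit_isSome hb hl (by rwa [Denumerable.ofNat_encode])

/-- The branch that interleaves two reals, above the root entry. -/
noncomputable def joinBranch (A B : Set ℕ) : ℕ → Bool
  | 0 => true
  | q + 1 => if q % 2 = 0 then boolChar A (q / 2) else boolChar B (q / 2)

theorem agreesOn_zero_of_isPrefixOf {A B : Set ℕ} {r : List (Bool × ℕ)}
    (h : IsPrefixOf (joinBranch A B) r) : AgreesOn 0 (boolChar A) r := by
  intro k b hb
  rw [h _ b hb]
  simp [joinBranch]

theorem agreesOn_one_of_isPrefixOf {A B : Set ℕ} {r : List (Bool × ℕ)}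
    (h : IsPrefixOf (joinBranch A B) r) : AgreesOn 1 (boolChar B) r := by
  intro k b hb
  rw [h _ b hb, show 2 * k + 1 + 1 = (2 * k + 1) + 1 from rfl, joinBranch, if_neg (by omega)]
  congr 1
  omega

theorem exists_hit {c : Code} (hc : HasDensityOne (Code.eval c).Dom) (A B : Set ℕ) :
    ∃ m s x, firstHit (Encodable.encode c) m s = some x ∧
      indexStack (Encodable.encode c) m <:+ indexStack (Encodable.encode c) s ∧
      IsPrefixOf (joinBranch A B) (indexStack (Encodable.encode c) m) := by
  obtain ⟨b, -, hb⟩ := exists_restart_of_hasDensityOne hc 0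
  obtain ⟨t, hbt, ht⟩ := exists_restart_of_hasDensityOne hc b
  obtain ⟨m, s, -, -, hs, hhit, hpre⟩ :=
    exists_hit_between_restarts (Y := joinBranch A B) rfl hb ht hbt
  obtain ⟨x, hx⟩ := Option.isSome_iff_exists.1 hhit
  exact ⟨m, s, x, hx, hs, hpre⟩

/-- The stage by which a complete search starting after stage `n` is finished is a computable
function of `n`.  An undominated function `f` exceeds it at some `n`, and being monotone, `f` then
bounds the search time at every stage of that search. -/
theorem exists_hit_le {c : Code} (hc : HasDensityOne (Code.eval c).Dom) (A B : Set ℕ)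
    {f : ℕ → ℕ} (hf : Monotone f) (hfd : ¬ IsDominated f) :
    ∃ m s x, firstHit (Encodable.encode c) m s = some x ∧ s ≤ f m ∧
      indexStack (Encodable.encode c) m <:+ indexStack (Encodable.encode c) s ∧
      IsPrefixOf (joinBranch A B) (indexStack (Encodable.encode c) m) := by
  set e := Encodable.encode c with he
  let p : ℕ → ℕ → Bool := fun n j =>
    decide (n ≤ j.unpair.1) && (decide (j.unpair.1 < j.unpair.2) &&
      ((indexStack e j.unpair.1 == [(true, j.unpair.1)]) &&
        (indexStack e j.unpair.2 == [(true, j.unpair.2)])))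
  have hp : Computable₂ p := by
    have hb : Primrec fun a : ℕ × ℕ => a.2.unpair.1 :=
      Primrec.fst.comp (Primrec.unpair.comp Primrec.snd)
    have ht : Primrec fun a : ℕ × ℕ => a.2.unpair.2 :=
      Primrec.snd.comp (Primrec.unpair.comp Primrec.snd)
    have hroot : Primrec fun k : ℕ => [(true, k)] :=
      Primrec.list_cons.comp ((Primrec.const true).pair Primrec.id) (Primrec.const [])
    have hstack : Primrec fun k : ℕ => indexStack e k == [(true, k)] :=
      primrec_beq (primrec_indexStack.comp (Primrec.const e) Primrec.id) hroot
    exact (Primrec.and.comp (Primrec.nat_le.decide.comp Primrec.fst hb)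
      (Primrec.and.comp (Primrec.nat_lt.decide.comp hb ht)
        (Primrec.and.comp (hstack.comp hb) (hstack.comp ht)))).to_comp
  have hpiff : ∀ n j, p n j = true ↔ n ≤ j.unpair.1 ∧ j.unpair.1 < j.unpair.2 ∧
      indexStack e j.unpair.1 = [(true, j.unpair.1)] ∧
      indexStack e j.unpair.2 = [(true, j.unpair.2)] := by
    intro n j
    simp [p]
  have hex : ∀ n, ∃ j, p n j = true := by
    intro n
    obtain ⟨b, hnb, hb⟩ := exists_restart_of_hasDensityOne hc n
    obtain ⟨t, hbt, ht⟩ := exists_restart_of_hasDensityOne hc b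
    refine ⟨Nat.pair b t, (hpiff _ _).2 ?_⟩
    rw [Nat.unpair_pair]
    exact ⟨hnb.le, hbt, hb, ht⟩
  by_contra hno
  refine hfd ⟨fun n => (Nat.find (hex n)).unpair.2,
    Computable.snd.comp (Computable.unpair.comp (computable_find hp hex)), fun n => ?_⟩
  by_contra hlt
  obtain ⟨hnb, hbt, hb, ht⟩ := (hpiff _ _).1 (Nat.find_spec (hex n))
  obtain ⟨m, s, hbm, hst, hs, hhit, hpre⟩ :=
    exists_hit_between_restarts (Y := joinBranch A B) rfl hb ht hbt
  obtain ⟨x, hx⟩ := Option.isSome_iff_exists.1 hhit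
  have hfm := hf (hnb.trans hbm)
  simp only at hlt
  exact hno ⟨m, s, x, hx, by omega, hs, hpre⟩

theorem mem_boundedHits {e m s x : ℕ} {f : ℕ → ℕ} (hx : firstHit e m s = some x) (hs : s ≤ f m) :
    x ∈ boundedHits f := by
  obtain ⟨hb, hl, -⟩ := firstHit_spec hx
  subst hb hl
  exact firstHit_mono hs hx

/-! ### Diagonalization -/

/-- On `E ∩ E'` neither generic computation has to give a value, so the real can be made to differ
there from any partial recursive function.  Using only the elements of block `e` against the `e`-th
function keeps the requirements for different functions apart. -/
theorem exists_real_of_isNegligibleFrom {A B E E' : Set ℕ} (hE : IsNegligibleFrom A E)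
    (hE' : IsNegligibleFrom B E')
    (hmeet : ∀ c : Code, HasDensityOne (Code.eval c).Dom →
      ∃ m s x, firstHit (Encodable.encode c) m s = some x ∧ x ∈ E ∧ x ∈ E') :
    ∃ C : Set ℕ, ¬ GenericallyComputable C ∧
      GenericallyComputableFrom A C ∧ GenericallyComputableFrom B C := by
  let C : Set ℕ :=
    {x | x ∈ E ∧ x ∈ E' ∧ 0 ∈ Code.eval (Denumerable.ofNat Code (block x)) x}
  have key : ∀ Z F : Set ℕ, IsNegligibleFrom Z F → C ⊆ F → GenericallyComputableFrom Z C := by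
    rintro Z F ⟨hd, φ, hφ, hdom, h0⟩ hCF
    refine ⟨φ, hφ, by rwa [hdom], fun n b hb => Or.inl (h0 n b hb), fun n h => ?_, fun n h hn => ?_⟩
    · exact absurd (h0 n 1 h) one_ne_zero
    · have hmem : n ∈ φ.Dom := Part.dom_iff_mem.2 ⟨0, h⟩
      rw [hdom] at hmem
      exact hmem (hCF hn)
  refine ⟨C, ?_, key A E hE fun x hx => hx.1, key B E' hE' fun x hx => hx.2.1⟩
  rintro ⟨φ, hφ, hgen⟩
  obtain ⟨c, rfl⟩ := Code.exists_code.1 (Partrec.nat_iff.1 hφ)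
  obtain ⟨m, s, x, hx, hxE, hxE'⟩ := hmeet c hgen.dom_density
  obtain ⟨hb, -, hdom⟩ := firstHit_spec hx
  rw [Denumerable.ofNat_encode] at hdom
  obtain ⟨b, hbx⟩ := Part.dom_iff_mem.1 hdom
  rcases hgen.zero_or_one x b hbx with rfl | rfl
  · refine hgen.notMem_of_zero x hbx ⟨hxE, hxE', ?_⟩
    rwa [hb, Denumerable.ofNat_encode]
  · have h0 := (hgen.mem_of_one x hbx).2.2
    rw [hb, Denumerable.ofNat_encode] at h0
    exact absurd (Part.mem_unique hbx h0) one_ne_zero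

theorem exists_real_of_not_isLimitComputable {A B : Set ℕ} (hA : ¬ IsLimitComputable A)
    (hB : ¬ IsRecursive B) :
    ∃ C : Set ℕ, ¬ GenericallyComputable C ∧
      GenericallyComputableFrom A C ∧ GenericallyComputableFrom B C := by
  by_cases hBl : IsLimitComputable B
  · obtain ⟨f, hf, hmono, hfd⟩ := exists_not_isDominated hBl hB
    refine exists_real_of_isNegligibleFrom (isNegligibleFrom_pendingHits 0 hA)
      (isNegligibleFrom_boundedHits hf) fun c hc => ?_
    obtain ⟨m, s, x, hx, hsf, hs, hpre⟩ := exists_hit_le hc A B hmono hfd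
    exact ⟨m, s, x, hx, mem_pendingHits hx hs (agreesOn_zero_of_isPrefixOf hpre),
      mem_boundedHits hx hsf⟩
  · refine exists_real_of_isNegligibleFrom (isNegligibleFrom_pendingHits 0 hA)
      (isNegligibleFrom_pendingHits 1 hBl) fun c hc => ?_
    obtain ⟨m, s, x, hx, hs, hpre⟩ := exists_hit hc A B
    exact ⟨m, s, x, hx, mem_pendingHits hx hs (agreesOn_zero_of_isPrefixOf hpre),
      mem_pendingHits hx hs (agreesOn_one_of_isPrefixOf hpre)⟩

theorem exists_real_of_not_isRecursive {A B : Set ℕ} (hA : ¬ IsRecursive A)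
    (hB : ¬ IsRecursive B) :
    ∃ C : Set ℕ, ¬ GenericallyComputable C ∧
      GenericallyComputableFrom A C ∧ GenericallyComputableFrom B C := by
  by_cases hAl : IsLimitComputable A
  swap
  · exact exists_real_of_not_isLimitComputable hAl hB
  by_cases hBl : IsLimitComputable B
  swap
  · obtain ⟨C, h1, h2, h3⟩ := exists_real_of_not_isLimitComputable hBl hA
    exact ⟨C, h1, h3, h2⟩
  obtain ⟨f, hf, hfm, hfd⟩ := exists_not_isDominated hAl hA
  obtain ⟨g₀, hg₀, hgm₀, hgd₀⟩ := exists_not_isDominated hBl hB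
  obtain ⟨g, hg, hgm, hd⟩ := exists_min_not_isDominated hg₀ hfm hgm₀ hfd hgd₀
  refine exists_real_of_isNegligibleFrom (isNegligibleFrom_boundedHits hf)
    (isNegligibleFrom_boundedHits hg) fun c hc => ?_
  obtain ⟨m, s, x, hx, hs, -⟩ := exists_hit_le hc A B (hfm.min hgm) hd
  exact ⟨m, s, x, hx, mem_boundedHits hx (hs.trans (min_le_left _ _)),
    mem_boundedHits hx (hs.trans (min_le_right _ _))⟩

theorem genericallyComputable_of_isRecursive {A : Set ℕ} (h : IsRecursive A) :
    GenericallyComputable A := by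
  classical
  obtain ⟨_, hc⟩ := h
  have hdom : PFun.Dom (fun n => Part.some (decide (n ∈ A)).toNat : ℕ →. ℕ) = (∅ : Set ℕ)ᶜ := by
    ext n
    simp
  refine ⟨fun n => Part.some (decide (n ∈ A)).toNat, ?_, ?_, ?_, ?_, ?_⟩
  · exact ((Primrec.dom_bool Bool.toNat).to_comp.comp hc).of_eq fun n => by simp
  · rw [hdom]
    exact hasDensityOne_compl fun e => ⟨0, fun n _ x hx => absurd hx (Set.notMem_empty x)⟩
  · intro n b hb
    rw [Part.mem_some_iff] at hb
    by_cases hn : n ∈ A <;> simp [hb, hn]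
  · intro n hb
    by_contra hn
    simp [hn] at hb
  · intro n hb hn
    simp [hn] at hb

theorem mainTheorem1 :
    (∀ A B : Set ℕ, ¬ IsRecursive A → ¬ IsRecursive B →
      ∃ C : Set ℕ, ¬ GenericallyComputable C ∧
        GenericallyComputableFrom A C ∧ GenericallyComputableFrom B C) ∧
    (∀ A B : Set ℕ, ¬ GenericallyComputable A → ¬ GenericallyComputable B →
      ∃ C : Set ℕ, ¬ GenericallyComputable C ∧
        GenericallyComputableFrom A C ∧ GenericallyComputableFrom B C) ∧
    ¬ ∃ A B : Set ℕ, IsMinimalPairForGenericComputability A B := by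
  refine ⟨fun A B hA hB => exists_real_of_not_isRecursive hA hB,
    fun A B hA hB => exists_real_of_not_isRecursive
      (fun h => hA (genericallyComputable_of_isRecursive h))
      (fun h => hB (genericallyComputable_of_isRecursive h)), ?_⟩
  rintro ⟨A, B, hA, hB, h⟩
  obtain ⟨C, hC, hCA, hCB⟩ := exists_real_of_not_isRecursive hA hB
  exact hC (h C hCA hCB)
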